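/- Let $q$ be a complex number with $|q|<1$. For $k\ge 1$ let $$E_{2k}(q)=1-\frac{4k}{B_{2k}}\sum_{n\ge1}\sigma_{2k-1}(n)q^n,\qquad \sigma_{j}(n)=\sum_{d\mid n}d^{j},$$ where $B_{2k}$ is the $2k$-th Bernoulli number, and for an integer $t\ge 0$ let $$V_{2t}(q)=\frac{\sum_{n\in\mathbb Z}(-1)^n(6n-1)^{2t}q^{n(3n-1)/2}}{\sum_{n\in\mathbb Z}(-1)^nq^{n(3n-1)/2}} =\frac{1^{2t}-5^{2t}q-7^{2t}q^2+11^{2t}q^5+13^{2t}q^7-\cdots}{1-q-q^2+q^5+q^7-\cdots}.$$ Define integers $c_v(\alpha,\beta,\gamma)$ for $\alpha,\beta,\gamma\in\mathbb Z$ by $c_v(\alpha,\beta,\gamma)=0$ if any argument is negative, $c_v(0,0,0)=1$, and, for all other $\alpha,\beta,\gamma\ge0$, $$\begin{aligned}c_v(\alpha,\beta,\gamma)={}&(2\alpha+8\beta+12\gamma-1)\,c_v(\alpha-1,\beta,\gamma)-2(\alpha+1)\,c_v(\alpha+1,\beta-1,\gamma)\\&-8(\beta+1)\,c_v(\alpha,\beta+1,\gamma-1)-12(\gamma+1)\,c_v(\alpha,\beta-2,\gamma+1).\end{aligned}$$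 Then all the series above converge absolutely, the denominator of $V_{2t}(q)$ is nonzero, and for every integer $t\ge0$ $$V_{2t}(q)=\sum_{\substack{\alpha,\beta,\gamma\ge0\\ \alpha+2\beta+3\gamma=t}}c_v(\alpha,\beta,\gamma)\,E_2(q)^{\alpha}E_4(q)^{\beta}E_6(q)^{\gamma}.$$ -/

import Mathlib

namespace RamanujanV

/-- The summand `(σ_{2k-1}(n)) q^n`, `n ≥ 1`, of the Eisenstein series `E_{2k}`. -/
noncomputable def eisensteinTerm (k : ℕ) (q : ℂ) (n : ℕ+) : ℂ :=
  (ArithmeticFunction.sigma (2 * k - 1) (n : ℕ) : ℂ) * q ^ (n : ℕ)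

/-- The Eisenstein series `E_{2k}(q) = 1 - (4k / B_{2k}) ∑_{n ≥ 1} σ_{2k-1}(n) q^n`, for `k ≥ 1`.
The index is `k`, so `eisenstein 1`, `eisenstein 2`, `eisenstein 3` are `E_2`, `E_4`, `E_6`. -/
noncomputable def eisenstein (k : ℕ) (q : ℂ) : ℂ :=
  1 - (4 * (k : ℂ) / ((bernoulli (2 * k) : ℚ) : ℂ)) * ∑' n : ℕ+, eisensteinTerm k q n

/-- The term `(-1)^n (6n-1)^{2t} q^{n(3n-1)/2}`, `n ∈ ℤ`. In the order `n = 0, 1, -1, 2, -2, …`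
these are `1^{2t}`, `-5^{2t} q`, `-7^{2t} q^2`, `11^{2t} q^5`, `13^{2t} q^7`, …. -/
noncomputable def numeratorTerm (t : ℕ) (q : ℂ) (n : ℤ) : ℂ :=
  ((n.negOnePow : ℤ) : ℂ) * ((6 * n - 1 : ℤ) : ℂ) ^ (2 * t) * q ^ pentagonal n

/-- The term `(-1)^n q^{n(3n-1)/2}`, `n ∈ ℤ`. In the order `n = 0, 1, -1, 2, -2, …`
these are `1`, `-q`, `-q^2`, `q^5`, `q^7`, …. -/
noncomputable def denominatorTerm (q : ℂ) (n : ℤ) : ℂ :=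
  ((n.negOnePow : ℤ) : ℂ) * q ^ pentagonal n

/-- Ramanujan's `V_{2t}(q)`. -/
noncomputable def V (t : ℕ) (q : ℂ) : ℂ :=
  (∑' n : ℤ, numeratorTerm t q n) / (∑' n : ℤ, denominatorTerm q n)

/-- The integers `c_v(α, β, γ)`: zero if an argument is negative, `c_v(0, 0, 0) = 1`, and
otherwise given by the four-term recursion. -/
def cv (α β γ : ℤ) : ℤ :=
  if α < 0 ∨ β < 0 ∨ γ < 0 then 0
  else if α = 0 ∧ β = 0 ∧ γ = 0 then 1
  else
    (2 * α + 8 * β + 12 * γ - 1) * cv (α - 1) β γ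
      - 2 * (α + 1) * cv (α + 1) (β - 1) γ
      - 8 * (β + 1) * cv α (β + 1) (γ - 1)
      - 12 * (γ + 1) * cv α (β - 2) (γ + 1)
termination_by (α + 2 * β + 3 * γ).toNat
decreasing_by all_goals omega

/-- The triples `(α, β, γ)` of non-negative integers with `α + 2β + 3γ = t`. -/
def weightTriples (t : ℕ) : Finset (ℕ × ℕ × ℕ) :=
  (Finset.range (t + 1) ×ˢ Finset.range (t + 1) ×ˢ Finset.range (t + 1)).filter
    fun p => p.1 + 2 * p.2.1 + 3 * p.2.2 = t

/-- The bounds in `weightTriples` exclude no solution. -/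
theorem mem_weightTriples (t α β γ : ℕ) :
    (α, β, γ) ∈ weightTriples t ↔ α + 2 * β + 3 * γ = t := by
  simp only [weightTriples, Finset.mem_filter, Finset.mem_product, Finset.mem_range]
  omega

end RamanujanV

namespace RamanujanV

/-! ### Power series with polynomially bounded coefficients -/

section Series

variable {ι : Type*} {a : ι → ℂ} {m : ι → ℕ} {C : ℝ} {s : ℕ}

/-! Write `θ = q d/dq` and let `N_t` be the numerator of `V_{2t}`. Since `(6n-1)^2 = 24·n(3n-1)/2 +
1`, termwise differentiation gives `N_{t+1} = (1 + 24θ) N_t` (`numerator_succ`). By Euler's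
pentagonal theorem `N_0 = ∏ (1 - q^n)`. It therefore has no zero in the disc, and the logarithmic
derivative of `η` gives `N_1 = E_2 N_0` (`numerator_one`).

If `N_t = P_t N_0`, the product rule yields `P_{t+1} = E_2 P_t + 24 θ P_t`. Ramanujan's equations
for `θE_2`, `θE_4`, `θE_6` turn this into an operator on polynomials in `E_2, E_4, E_6`, and reading
off coefficients gives exactly the recursion for `c_v` (`sum_cv_succ`, `eisensteinPolynomial_succ`).
Ramanujan's equations hold because each difference of the two sides is a level one form of weight 4,
6 or 8 vanishing at infinity, hence zero. -/

lemma summable_succ_pow_mul_pow (s : ℕ) {r : ℝ} (hr₀ : 0 ≤ r) (hr : r < 1) :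
    Summable fun n : ℕ ↦ ((n : ℝ) + 1) ^ s * r ^ n := by
  rcases hr₀.eq_or_lt with rfl | hr₀
  · refine summable_of_ne_finset_zero (s := {0}) fun n hn ↦ ?_
    simp_all
  have h := summable_pow_mul_geometric_of_norm_lt_one s
    (show ‖r‖ < 1 by rwa [Real.norm_of_nonneg hr₀.le])
  refine (((summable_nat_add_iff 1).2 h).mul_right r⁻¹).congr fun n ↦ ?_
  push_cast
  rw [pow_succ]
  field_simp

lemma summable_norm_mul_pow_of_le (hm : Function.Injective m)
    (ha : ∀ i, ‖a i‖ ≤ C * ((m i : ℝ) + 1) ^ s) {r : ℝ} (hr₀ : 0 ≤ r) (hr : r < 1) :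
    Summable fun i ↦ ‖a i‖ * r ^ m i := by
  refine .of_nonneg_of_le (fun i ↦ by positivity) (fun i ↦ ?_)
    (((summable_succ_pow_mul_pow s hr₀ hr).mul_left C).comp_injective hm)
  simpa [mul_assoc] using mul_le_mul_of_nonneg_right (ha i) (pow_nonneg hr₀ (m i))

lemma summable_mul_pow_of_le (hm : Function.Injective m)
    (ha : ∀ i, ‖a i‖ ≤ C * ((m i : ℝ) + 1) ^ s) {q : ℂ} (hq : ‖q‖ < 1) :
    Summable fun i ↦ a i * q ^ m i := by
  refine .of_norm ((summable_norm_mul_pow_of_le hm ha (norm_nonneg q) hq).congr fun i ↦ ?_)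
  simp

/-- Applying `q d/dq` costs one power in the growth bound, so polynomial growth is preserved. -/
lemma norm_mul_natCast_le (ha : ∀ i, ‖a i‖ ≤ C * ((m i : ℝ) + 1) ^ s) (i : ι) :
    ‖a i * m i‖ ≤ C * ((m i : ℝ) + 1) ^ (s + 1) := by
  rw [norm_mul, Complex.norm_natCast, pow_succ, ← mul_assoc]
  have := ha i
  gcongr
  · exact (norm_nonneg _).trans this
  · linarith

/-- A power series whose coefficients grow polynomially may be differentiated term by term in the
unit disc. -/
lemma hasDerivAt_tsum_mul_pow (hm : Function.Injective m)
    (ha : ∀ i, ‖a i‖ ≤ C * ((m i : ℝ) + 1) ^ s) {q : ℂ} (hq : ‖q‖ < 1) :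
    HasDerivAt (fun q : ℂ ↦ ∑' i, a i * q ^ m i) (∑' i, a i * (m i * q ^ (m i - 1))) q := by
  obtain ⟨r, hqr, hr⟩ := exists_between hq
  have hr₀ : 0 < r := (norm_nonneg q).trans_lt hqr
  have hu := (summable_norm_mul_pow_of_le hm (norm_mul_natCast_le ha) hr₀.le hr).mul_right r⁻¹
  refine hasDerivAt_tsum_of_isPreconnected hu Metric.isOpen_ball
    (convex_ball (0 : ℂ) r).isPreconnected (fun i y _ ↦ (hasDerivAt_pow (m i) y).const_mul (a i))
    (fun i y hy ↦ ?_) (y₀ := q) (by simpa using hqr) (summable_mul_pow_of_le hm ha hq)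
    (by simpa using hqr)
  rw [← mul_assoc, norm_mul, norm_pow, mul_assoc _ _ r⁻¹]
  refine mul_le_mul_of_nonneg_left ?_ (norm_nonneg _)
  have hy : ‖y‖ ≤ r := by simpa using (Metric.mem_ball.1 hy).le
  -- When `m i = 0` the truncated exponent `m i - 1` is `0`, and the bound becomes `1 ≤ r⁻¹`.
  rcases Nat.eq_zero_or_pos (m i) with h0 | h0
  · simpa [h0] using (one_le_inv₀ hr₀).2 hr.le
  · calc ‖y‖ ^ (m i - 1) ≤ r ^ (m i - 1) := by gcongr
      _ = r ^ m i * r⁻¹ := by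
        rw [pow_sub₀ _ hr₀.ne' h0, pow_one]

/-- The Euler operator `q d/dq` multiplies the `i`-th term by its exponent. -/
lemma mul_deriv_tsum_mul_pow (hm : Function.Injective m)
    (ha : ∀ i, ‖a i‖ ≤ C * ((m i : ℝ) + 1) ^ s) {q : ℂ} (hq : ‖q‖ < 1) :
    q * deriv (fun q : ℂ ↦ ∑' i, a i * q ^ m i) q = ∑' i, a i * m i * q ^ m i := by
  rw [(hasDerivAt_tsum_mul_pow hm ha hq).deriv, ← tsum_mul_left]
  refine tsum_congr fun i ↦ ?_
  rcases Nat.eq_zero_or_pos (m i) with h0 | h0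
  · simp [h0]
  · obtain ⟨k, hk⟩ := Nat.exists_eq_succ_of_ne_zero h0.ne'
    rw [hk, Nat.succ_sub_one, pow_succ]
    ring

end Series

/-! ### The theta-type series -/

lemma twentyFour_mul_pentagonal_add_one (n : ℤ) :
    24 * (pentagonal n : ℤ) + 1 = (6 * n - 1) ^ 2 := by
  linear_combination 12 * two_mul_natCast_pentagonal n

/-- The coefficients `(-1)^n (6n-1)^{2t}`. -/
noncomputable def numeratorCoeff (t : ℕ) (n : ℤ) : ℂ :=
  ((n.negOnePow : ℤ) : ℂ) * ((6 * n - 1 : ℤ) : ℂ) ^ (2 * t)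

lemma numeratorCoeff_eq (t : ℕ) (n : ℤ) :
    numeratorCoeff t n = ((n.negOnePow : ℤ) : ℂ) * (24 * pentagonal n + 1) ^ t := by
  rw [numeratorCoeff, pow_mul]
  congr 2
  exact_mod_cast (twentyFour_mul_pentagonal_add_one n).symm

lemma norm_negOnePow (n : ℤ) : ‖((n.negOnePow : ℤ) : ℂ)‖ = 1 := by
  rcases Int.units_eq_one_or n.negOnePow with h | h <;> simp [h]

lemma norm_numeratorCoeff_le (t : ℕ) (n : ℤ) :
    ‖numeratorCoeff t n‖ ≤ 24 ^ t * ((pentagonal n : ℝ) + 1) ^ t := by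
  rw [numeratorCoeff_eq, norm_mul, norm_negOnePow, one_mul, norm_pow, ← mul_pow]
  gcongr
  have : (24 * pentagonal n + 1 : ℂ) = ((24 * pentagonal n + 1 : ℕ) : ℂ) := by push_cast; rfl
  rw [this, Complex.norm_natCast]
  push_cast
  linarith

lemma summable_numeratorTerm (t : ℕ) {q : ℂ} (hq : ‖q‖ < 1) : Summable (numeratorTerm t q) :=
  summable_mul_pow_of_le pentagonal_injective (norm_numeratorCoeff_le t) hq

lemma numeratorTerm_zero (q : ℂ) : numeratorTerm 0 q = denominatorTerm q := by
  ext n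
  simp [numeratorTerm, denominatorTerm]

lemma summable_denominatorTerm {q : ℂ} (hq : ‖q‖ < 1) : Summable (denominatorTerm q) :=
  numeratorTerm_zero q ▸ summable_numeratorTerm 0 hq

/-- The numerator of `V_{2t}`. -/
noncomputable def numerator (t : ℕ) (q : ℂ) : ℂ := ∑' n : ℤ, numeratorTerm t q n

lemma differentiableAt_numerator (t : ℕ) {q : ℂ} (hq : ‖q‖ < 1) :
    DifferentiableAt ℂ (numerator t) q :=
  (hasDerivAt_tsum_mul_pow pentagonal_injective (norm_numeratorCoeff_le t) hq).differentiableAt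

/-- The numerators satisfy `N_{t+1} = N_t + 24 q dN_t/dq`. -/
lemma numerator_succ (t : ℕ) {q : ℂ} (hq : ‖q‖ < 1) :
    numerator (t + 1) q = numerator t q + 24 * (q * deriv (numerator t) q) := by
  have hd : q * deriv (numerator t) q =
      ∑' n : ℤ, numeratorCoeff t n * pentagonal n * q ^ pentagonal n :=
    mul_deriv_tsum_mul_pow pentagonal_injective (norm_numeratorCoeff_le t) hq
  have hs := summable_mul_pow_of_le pentagonal_injective
    (norm_mul_natCast_le (norm_numeratorCoeff_le t)) hq
  rw [hd, ← tsum_mul_left, numerator, numerator,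
    ← (summable_numeratorTerm t hq).tsum_add (hs.mul_left 24)]
  refine tsum_congr fun n ↦ ?_
  change numeratorCoeff (t + 1) n * _ = numeratorCoeff t n * _ + _
  rw [numeratorCoeff_eq, numeratorCoeff_eq]
  ring

/-! ### Eisenstein series -/

lemma norm_sigma_le (j n : ℕ) :
    ‖(ArithmeticFunction.sigma j n : ℂ)‖ ≤ 1 * ((n : ℝ) + 1) ^ (j + 1) := by
  rw [Complex.norm_natCast, one_mul]
  exact_mod_cast (ArithmeticFunction.sigma_le_pow_succ j n).trans (by gcongr; omega)

lemma summable_eisensteinTerm (k : ℕ) {q : ℂ} (hq : ‖q‖ < 1) : Summable (eisensteinTerm k q) :=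
  summable_mul_pow_of_le PNat.coe_injective (fun n ↦ norm_sigma_le (2 * k - 1) n) hq

lemma differentiableAt_eisenstein (k : ℕ) {q : ℂ} (hq : ‖q‖ < 1) :
    DifferentiableAt ℂ (eisenstein k) q :=
  ((hasDerivAt_tsum_mul_pow PNat.coe_injective
    (fun n ↦ norm_sigma_le (2 * k - 1) n) hq).differentiableAt.const_mul _).const_sub 1

lemma eisenstein_zero_right (k : ℕ) : eisenstein k 0 = 1 := by
  simp [eisenstein, eisensteinTerm]

end RamanujanV

namespace RamanujanV

open Filter Topology

/-! ### The pentagonal number theorem in the unit disc -/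

/-- Comparison with `∏ (1 + ‖q‖^i) ≤ exp (∑ ‖q‖^i)`; uniformity in `k` is what later makes the
remainder tend to zero. -/
lemma norm_prod_one_sub_pow_le {q : ℂ} (hq : ‖q‖ < 1) (k n : ℕ) :
    ‖∏ i ∈ Finset.range n, (1 - q ^ (k + i + 1))‖ ≤ Real.exp (1 - ‖q‖)⁻¹ := by
  have hs := summable_geometric_of_lt_one (norm_nonneg q) hq
  calc ‖∏ i ∈ Finset.range n, (1 - q ^ (k + i + 1))‖
      ≤ ∏ i ∈ Finset.range n, (1 + ‖q‖ ^ i) := by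
        rw [norm_prod]
        refine Finset.prod_le_prod (fun _ _ ↦ norm_nonneg _) fun i _ ↦ ?_
        refine (norm_sub_le _ _).trans ?_
        rw [norm_one, norm_pow]
        have := pow_le_pow_of_le_one (norm_nonneg q) hq.le (show i ≤ k + i + 1 by omega)
        gcongr
    _ ≤ Real.exp (∑ i ∈ Finset.range n, ‖q‖ ^ i) :=
        Real.prod_one_add_le_exp_sum _ fun _ ↦ by positivity
    _ ≤ Real.exp (1 - ‖q‖)⁻¹ := by
        rw [Real.exp_le_exp, ← tsum_geometric_of_lt_one (norm_nonneg q) hq]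
        exact hs.sum_le_tsum _ fun _ _ ↦ by positivity

lemma norm_pow_mul_prod_one_sub_pow_le {q : ℂ} (hq : ‖q‖ < 1) (k n : ℕ) :
    ‖q ^ ((k + 1) * n) * ∏ i ∈ Finset.range (n + 1), (1 - q ^ (k + i + 1))‖ ≤
      ‖q‖ ^ n * Real.exp (1 - ‖q‖)⁻¹ := by
  rw [norm_mul, norm_pow]
  exact mul_le_mul
    (pow_le_pow_of_le_one (norm_nonneg q) hq.le (Nat.le_mul_of_pos_left n k.succ_pos))
    (norm_prod_one_sub_pow_le hq k (n + 1)) (norm_nonneg _) (by positivity)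

lemma hasSum_pentagonal_nat {q : ℂ} (hq : ‖q‖ < 1) :
    HasSum (fun k : ℕ ↦ (-1) ^ k * (q ^ pentagonal (-k) - q ^ pentagonal (k + 1)))
      (∑' n : ℤ, denominatorTerm q n) := by
  have h := (summable_denominatorTerm hq).hasSum
  -- Reflecting `n ↦ -n` turns the pairing of `k` with `-(k+1)` into that of `-k` with `k+1`.
  rw [← neg_injective.hasSum_iff (fun x hx ↦ by absurd hx; use -x; simp)] at h
  convert h.nat_add_neg_add_one using 2 with k
  simp only [Function.comp_apply, neg_neg, denominatorTerm, Int.negOnePow_add, Int.negOnePow_neg]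
  simp
  ring

/-- **Euler's pentagonal number theorem** for complex numbers. -/
theorem tprod_one_sub_pow_eq_tsum {q : ℂ} (hq : ‖q‖ < 1) :
    ∏' n : ℕ, (1 - q ^ (n + 1)) = ∑' n : ℤ, denominatorTerm q n := by
  have hs := summable_geometric_of_lt_one (norm_nonneg q) hq
  rw [← (hasSum_pentagonal_nat hq).tsum_eq]
  refine Pentagonal.tprod_one_sub_pow ?_ (fun k ↦ ?_) (fun k ↦ ?_)
    (hasSum_pentagonal_nat hq).summable ?_
  · exact tendsto_pow_atTop_nhds_zero_of_norm_lt_one hq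
  · exact .of_norm_bounded (hs.mul_right _) fun n ↦ norm_pow_mul_prod_one_sub_pow_le hq k n
  · have := multipliable_one_add_of_summable (f := fun n : ℕ ↦ -q ^ (n + k + 1)) (by
      simpa [add_assoc] using (summable_nat_add_iff (k + 1)).2 hs)
    simpa [sub_eq_add_neg] using this
  -- The remainder at stage `k` is at most `‖q‖^k` times a constant, since the exponent of its
  -- prefactor is at least `k`.
  · set M := (1 - ‖q‖)⁻¹ * Real.exp (1 - ‖q‖)⁻¹
    have hbound (k : ℕ) : ‖(-1) ^ (k + 1) * q ^ ((k + 1) * (3 * k + 4) / 2) *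
        ∑' n : ℕ, q ^ ((k + 1) * n) * ∏ i ∈ Finset.range (n + 1), (1 - q ^ (k + i + 1))‖ ≤
          ‖q‖ ^ k * M := by
      rw [norm_mul, norm_mul, norm_pow, norm_pow, norm_neg, norm_one, one_pow, one_mul]
      refine mul_le_mul ?_ ?_ (norm_nonneg _) (by positivity)
      · refine pow_le_pow_of_le_one (norm_nonneg q) hq.le ?_
        rw [Nat.le_div_iff_mul_le two_pos]
        nlinarith
      · exact tsum_of_norm_bounded ((hasSum_geometric_of_lt_one (norm_nonneg q) hq).mul_right _)
          fun n ↦ norm_pow_mul_prod_one_sub_pow_le hq k n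
    refine squeeze_zero_norm hbound ?_
    simpa using (tendsto_pow_atTop_nhds_zero_of_lt_one (norm_nonneg q) hq).mul_const M

/-- An absolutely convergent product vanishes only if a factor does, and `q^(n+1) = 1` is impossible
in the disc. -/
lemma tsum_denominatorTerm_ne_zero {q : ℂ} (hq : ‖q‖ < 1) :
    (∑' n : ℤ, denominatorTerm q n) ≠ 0 := by
  rw [← tprod_one_sub_pow_eq_tsum hq]
  have hs := summable_geometric_of_lt_one (norm_nonneg q) hq
  have := tprod_one_add_ne_zero_of_summable (f := fun n : ℕ ↦ -q ^ (n + 1)) (fun n h ↦ ?_)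
    (by simpa using (summable_nat_add_iff 1).2 hs)
  · simpa [sub_eq_add_neg] using this
  · have h1 : q ^ (n + 1) = 1 := by linear_combination -h
    have h2 := congrArg norm h1
    rw [norm_pow, norm_one] at h2
    exact (pow_lt_one₀ (norm_nonneg q) hq n.succ_ne_zero).ne h2

end RamanujanV

namespace RamanujanV

open Filter Topology UpperHalfPlane EisensteinSeries Derivative ModularForm
open scoped MatrixGroups Manifold

/-! ### Ramanujan's differential equations -/

/-- A level one modular form of weight less than twelve that vanishes at infinity is zero. -/
lemma eq_zero_of_slash_invariant_of_tendsto_zero {k : ℤ} (hk : k < 12) {f : ℍ → ℂ} (hf : MDiff f)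
    (hinv : ∀ γ : SL(2, ℤ), f ∣[k] γ = f) (h0 : Tendsto f atImInfty (𝓝 0)) : f = 0 := by
  let F : CuspForm 𝒮ℒ k :=
    { toFun := f
      slash_action_eq' := fun _ ⟨γ, hγ⟩ ↦ hγ ▸ hinv γ
      holo' := hf
      zero_at_cusps' := fun {c} hc ↦ by
        -- Every cusp is an `SL(2, ℤ)`-translate of infinity, so invariance reduces the condition to
        -- `h0`.
        rw [Subgroup.IsArithmetic.isCusp_iff_isCusp_SL2Z] at hc
        rw [OnePoint.isZeroAt_iff_forall_SL2Z hc]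
        intro γ _
        rw [hinv γ]
        exact h0 }
  have hF : F = 0 := rank_zero_iff_forall_zero.mp (CuspForm.rank_eq_zero_of_weight_lt_twelve hk) F
  exact congrArg DFunLike.coe hF

/-- The nome `q = exp (2πiz)`. -/
noncomputable def nome (z : ℂ) : ℂ := Complex.exp (2 * Real.pi * Complex.I * z)

lemma norm_nome_lt_one (z : ℍ) : ‖nome z‖ < 1 := norm_exp_two_pi_I_lt_one z

lemma nome_eq_qParam (z : ℂ) : nome z = Function.Periodic.qParam 1 z := by
  simp [nome, Function.Periodic.qParam]

lemma tendsto_nome : Tendsto (fun z : ℍ ↦ nome z) atImInfty (𝓝 0) := by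
  simpa only [nome_eq_qParam] using qParam_tendsto_atImInfty one_pos

lemma exists_nome_eq {q : ℂ} (hq : ‖q‖ < 1) (hq₀ : q ≠ 0) : ∃ z : ℍ, nome z = q :=
  ⟨⟨_, Function.Periodic.im_invQParam_pos_of_norm_lt_one one_pos hq hq₀⟩, by
    rw [nome_eq_qParam]
    exact Function.Periodic.qParam_right_inv one_ne_zero hq₀⟩

lemma hasDerivAt_nome (z : ℂ) : HasDerivAt nome (2 * Real.pi * Complex.I * nome z) z := by
  have h := ((hasDerivAt_id z).const_mul (2 * Real.pi * Complex.I)).cexp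
  simp only [id, mul_one] at h
  rw [mul_comm]
  exact h

lemma E2_eq_eisenstein (z : ℍ) : E2 z = eisenstein 1 (nome z) := by
  rw [E2_eq_tsum_cexp, eisenstein]
  norm_num [eisensteinTerm, nome, bernoulli_two]

lemma E_four_eq_eisenstein (z : ℍ) : E₄ z = eisenstein 2 (nome z) := by
  rw [E₄, q_expansion_bernoulli _ ⟨2, rfl⟩, eisenstein]
  norm_num [eisensteinTerm, nome]

lemma E_six_eq_eisenstein (z : ℍ) : E₆ z = eisenstein 3 (nome z) := by
  rw [E₆, q_expansion_bernoulli _ ⟨3, rfl⟩, eisenstein]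
  norm_num [eisensteinTerm, nome]

/-- In terms of the nome, the normalized derivative is the Euler operator `q d/dq`. -/
lemma normalizedDeriv_eq_of_nome {f : ℍ → ℂ} {F : ℂ → ℂ} (hf : ∀ z : ℍ, f z = F (nome z))
    (hF : ∀ q : ℂ, ‖q‖ < 1 → DifferentiableAt ℂ F q) (z : ℍ) :
    D f z = nome z * deriv F (nome z) := by
  have h : f ∘ ofComplex =ᶠ[𝓝 (z : ℂ)] F ∘ nome := by
    filter_upwards [isOpen_upperHalfPlaneSet.mem_nhds z.im_pos] with w hw
    simp [hf, ofComplex_apply_of_im_pos hw]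
  have hd := (hF _ (norm_nome_lt_one z)).hasDerivAt.comp (z : ℂ) (hasDerivAt_nome z)
  rw [normalizedDerivOfComplex, h.deriv_eq, hd.deriv]
  have : (2 * Real.pi * Complex.I : ℂ) ≠ 0 := Complex.two_pi_I_ne_zero
  field_simp

lemma tendsto_comp_nome {F : ℂ → ℂ} (hF : DifferentiableAt ℂ F 0) :
    Tendsto (fun z : ℍ ↦ F (nome z)) atImInfty (𝓝 (F 0)) :=
  hF.continuousAt.tendsto.comp tendsto_nome

lemma tendsto_mul_deriv_comp_nome {F : ℂ → ℂ} (hF : ∀ q : ℂ, ‖q‖ < 1 → DifferentiableAt ℂ F q) :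
    Tendsto (fun z : ℍ ↦ nome z * deriv F (nome z)) atImInfty (𝓝 0) := by
  have hd : DifferentiableOn ℂ F (Metric.ball 0 1) := fun q hq ↦
    (hF q (by simpa using hq)).differentiableWithinAt
  have h := (hd.deriv Metric.isOpen_ball).differentiableAt (Metric.ball_mem_nhds (0 : ℂ) one_pos)
  simpa using tendsto_nome.mul (tendsto_comp_nome h)

lemma tendsto_normalizedDeriv {f : ℍ → ℂ} {F : ℂ → ℂ} (hf : ∀ z : ℍ, f z = F (nome z))
    (hF : ∀ q : ℂ, ‖q‖ < 1 → DifferentiableAt ℂ F q) : Tendsto (D f) atImInfty (𝓝 0) := by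
  rw [show D f = _ from funext (normalizedDeriv_eq_of_nome hf hF)]
  exact tendsto_mul_deriv_comp_nome hF

lemma tendsto_one_of_eq_eisenstein {f : ℍ → ℂ} {k : ℕ} (hf : ∀ z : ℍ, f z = eisenstein k (nome z)) :
    Tendsto f atImInfty (𝓝 1) := by
  rw [show f = _ from funext hf, ← eisenstein_zero_right k]
  exact tendsto_comp_nome (differentiableAt_eisenstein k (by simp))

lemma modularForm_slash {k : ℤ} (f : ModularForm 𝒮ℒ k) (γ : SL(2, ℤ)) : ⇑f ∣[k] γ = f :=
  f.slash_action_eq' _ ⟨γ, rfl⟩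

lemma hasDerivAt_D2 (γ : SL(2, ℤ)) (z : ℍ) : HasDerivAt (D2 γ ∘ ofComplex)
    (2 * Real.pi * Complex.I * -(γ 1 0 / denom γ z) ^ 2) z := by
  have hz := denom_ne_zero γ z
  have h := (hasDerivAt_denom_zpow (γ : GL (Fin 2) ℝ) (-1) z).const_mul
    (2 * Real.pi * Complex.I * (γ 1 0 : ℂ))
  have he : D2 γ ∘ ofComplex =ᶠ[𝓝 (z : ℂ)] fun w ↦
      2 * Real.pi * Complex.I * (γ 1 0 : ℂ) * denom γ w ^ (-1 : ℤ) := by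
    filter_upwards [isOpen_upperHalfPlaneSet.mem_nhds z.im_pos] with w hw
    simp [D2, ofComplex_apply_of_im_pos hw, div_eq_mul_inv]
  refine (h.congr_of_eventuallyEq he).congr_deriv ?_
  rw [show (-1 - 1 : ℤ) = -2 by norm_num, zpow_neg]
  simp
  field_simp

lemma normalizedDeriv_D2 (γ : SL(2, ℤ)) (z : ℍ) : D (D2 γ) z = -(γ 1 0 / denom γ z) ^ 2 := by
  rw [normalizedDerivOfComplex, (hasDerivAt_D2 γ z).deriv,
    inv_mul_cancel_left₀ Complex.two_pi_I_ne_zero]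

lemma mdifferentiable_D2 (γ : SL(2, ℤ)) : MDiff (D2 γ) := fun z ↦
  mdifferentiableAt_iff.2 (hasDerivAt_D2 γ z).differentiableAt

/-- Neither term is modular, because `E2` transforms with the anomaly `D2 γ`. The anomalies of `D
E2` and `E2² / 12`, linear and quadratic in `c/(cz+d)`, cancel. -/
lemma normalizedDeriv_E2_sub_slash (γ : SL(2, ℤ)) :
    (D E2 - (12⁻¹ : ℂ) • (E2 * E2)) ∣[(4 : ℤ)] γ = D E2 - (12⁻¹ : ℂ) • (E2 * E2) := by
  have h := normalizedDerivOfComplex_SL_slash (k := 2) E2_mdifferentiable (γ := γ)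
  have hm := mul_slash_SL2 2 2 γ E2 E2
  rw [E2_slash_action, normalizedDerivOfComplex_sub _ _ E2_mdifferentiable
    ((mdifferentiable_D2 γ).const_smul _),
    normalizedDerivOfComplex_smul _ _ (mdifferentiable_D2 γ)] at h
  rw [E2_slash_action] at hm
  ext z
  have h := congrFun h z
  have hm := congrFun hm z
  have hD2 : D2 γ z = 2 * Real.pi * Complex.I * (γ 1 0 / denom γ z) := by rw [D2, mul_div_assoc]
  simp only [Pi.sub_apply, Pi.smul_apply, Pi.mul_apply, smul_eq_mul, normalizedDeriv_D2, hD2,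
    riemannZeta_two, Int.reduceAdd, Int.cast_ofNat] at h hm
  rw [sub_eq_add_neg, SlashAction.add_slash, SlashAction.neg_slash, SL_smul_slash]
  simp only [Pi.add_apply, Pi.neg_apply, Pi.smul_apply, Pi.mul_apply, smul_eq_mul, hm]
  generalize (γ 1 0 / denom γ z : ℂ) = u at h
  have hπ : (Real.pi : ℂ) ≠ 0 := by simp [Real.pi_ne_zero]
  have hI : Complex.I ^ 2 = -1 := Complex.I_sq
  field_simp at h ⊢
  grind

lemma E2_ramanujan (z : ℍ) : D E2 z = (E2 z ^ 2 - E₄ z) / 12 := by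
  have h := eq_zero_of_slash_invariant_of_tendsto_zero (k := 4) (by norm_num)
    (f := D E2 - (12⁻¹ : ℂ) • (E2 * E2) + (12⁻¹ : ℂ) • ⇑E₄) ?_ (fun γ ↦ ?_) ?_
  · have := congrFun h z
    simp only [Pi.add_apply, Pi.sub_apply, Pi.smul_apply, Pi.mul_apply, Pi.zero_apply,
      smul_eq_mul] at this
    linear_combination this
  · exact ((normalizedDerivOfComplex_mdifferentiable E2_mdifferentiable).sub
      ((E2_mdifferentiable.mul E2_mdifferentiable).const_smul _)).add (E₄.holo'.const_smul _)
  · rw [SlashAction.add_slash, normalizedDeriv_E2_sub_slash, SL_smul_slash, modularForm_slash]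
  · have h2 := tendsto_one_of_eq_eisenstein E2_eq_eisenstein
    have h4 := tendsto_one_of_eq_eisenstein E_four_eq_eisenstein
    have hd := tendsto_normalizedDeriv E2_eq_eisenstein fun _ ↦ differentiableAt_eisenstein 1
    have := (hd.sub ((h2.mul h2).const_smul (12⁻¹ : ℂ))).add (h4.const_smul (12⁻¹ : ℂ))
    rw [show (0 : ℂ) = 0 - (12⁻¹ : ℂ) • (1 * 1) + (12⁻¹ : ℂ) • 1 by norm_num]
    exact this

/-- The Serre derivative `D E₄ - (4/12) E2 E₄` is modular of weight 6 with limit `-1/3`, so adding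
`E₆ / 3` leaves a cusp form. The same scheme in weight 8 handles `E₆`. -/
lemma E_four_ramanujan (z : ℍ) : D E₄ z = (E2 z * E₄ z - E₆ z) / 3 := by
  have h := eq_zero_of_slash_invariant_of_tendsto_zero (k := 6) (by norm_num)
    (f := serreDerivative (4 : ℤ) E₄ + (3⁻¹ : ℂ) • ⇑E₆) ?_ (fun γ ↦ ?_) ?_
  · have := congrFun h z
    simp only [Pi.add_apply, serreDerivative_apply, Pi.smul_apply, Pi.zero_apply, smul_eq_mul,
      Int.cast_ofNat] at this
    linear_combination this
  · exact (serreDerivative_mdifferentiable _ E₄.holo').add (E₆.holo'.const_smul _)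
  · rw [SlashAction.add_slash, SL_smul_slash, modularForm_slash]
    congr 1
    exact serreDerivative_slash_invariant E₄.holo' (modularForm_slash E₄ γ)
  · have h2 := tendsto_one_of_eq_eisenstein E2_eq_eisenstein
    have h4 := tendsto_one_of_eq_eisenstein E_four_eq_eisenstein
    have h6 := tendsto_one_of_eq_eisenstein E_six_eq_eisenstein
    have hd := tendsto_normalizedDeriv E_four_eq_eisenstein fun _ ↦ differentiableAt_eisenstein 2
    have := (hd.sub ((h2.const_mul ((4 : ℤ) * 12⁻¹ : ℂ)).mul h4)).add (h6.const_smul (3⁻¹ : ℂ))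
    rw [show (0 : ℂ) = 0 - (4 : ℤ) * 12⁻¹ * 1 * 1 + (3⁻¹ : ℂ) • 1 by norm_num]
    exact this

lemma E_six_ramanujan (z : ℍ) : D E₆ z = (E2 z * E₆ z - E₄ z ^ 2) / 2 := by
  have h := eq_zero_of_slash_invariant_of_tendsto_zero (k := 8) (by norm_num)
    (f := serreDerivative (6 : ℤ) E₆ + (2⁻¹ : ℂ) • (⇑E₄ * ⇑E₄)) ?_ (fun γ ↦ ?_) ?_
  · have := congrFun h z
    simp only [Pi.add_apply, serreDerivative_apply, Pi.smul_apply, Pi.mul_apply, Pi.zero_apply,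
      smul_eq_mul, Int.cast_ofNat] at this
    linear_combination this
  · exact (serreDerivative_mdifferentiable _ E₆.holo').add
      ((E₄.holo'.mul E₄.holo').const_smul _)
  · have hm := mul_slash_SL2 4 4 γ E₄ E₄
    rw [modularForm_slash] at hm
    rw [SlashAction.add_slash, SL_smul_slash]
    congr 1
    · exact serreDerivative_slash_invariant E₆.holo' (modularForm_slash E₆ γ)
    · exact congrArg _ hm
  · have h2 := tendsto_one_of_eq_eisenstein E2_eq_eisenstein
    have h4 := tendsto_one_of_eq_eisenstein E_four_eq_eisenstein
    have h6 := tendsto_one_of_eq_eisenstein E_six_eq_eisenstein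
    have hd := tendsto_normalizedDeriv E_six_eq_eisenstein fun _ ↦ differentiableAt_eisenstein 3
    have := (hd.sub ((h2.const_mul ((6 : ℤ) * 12⁻¹ : ℂ)).mul h6)).add
      ((h4.mul h4).const_smul (2⁻¹ : ℂ))
    rw [show (0 : ℂ) = 0 - (6 : ℤ) * 12⁻¹ * 1 * 1 + (2⁻¹ : ℂ) • (1 * 1) by norm_num]
    exact this

lemma mul_deriv_eisenstein_one {q : ℂ} (hq : ‖q‖ < 1) :
    q * deriv (eisenstein 1) q = (eisenstein 1 q ^ 2 - eisenstein 2 q) / 12 := by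
  -- The nome never takes the value `0`; there both sides vanish.
  rcases eq_or_ne q 0 with rfl | hq₀
  · simp [eisenstein_zero_right]
  · obtain ⟨z, rfl⟩ := exists_nome_eq hq hq₀
    rw [← normalizedDeriv_eq_of_nome E2_eq_eisenstein fun _ ↦ differentiableAt_eisenstein 1,
      E2_ramanujan, E2_eq_eisenstein, E_four_eq_eisenstein]

lemma mul_deriv_eisenstein_two {q : ℂ} (hq : ‖q‖ < 1) :
    q * deriv (eisenstein 2) q = (eisenstein 1 q * eisenstein 2 q - eisenstein 3 q) / 3 := by
  rcases eq_or_ne q 0 with rfl | hq₀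
  · simp [eisenstein_zero_right]
  · obtain ⟨z, rfl⟩ := exists_nome_eq hq hq₀
    rw [← normalizedDeriv_eq_of_nome E_four_eq_eisenstein fun _ ↦ differentiableAt_eisenstein 2,
      E_four_ramanujan, E2_eq_eisenstein, E_four_eq_eisenstein, E_six_eq_eisenstein]

lemma mul_deriv_eisenstein_three {q : ℂ} (hq : ‖q‖ < 1) :
    q * deriv (eisenstein 3) q = (eisenstein 1 q * eisenstein 3 q - eisenstein 2 q ^ 2) / 2 := by
  rcases eq_or_ne q 0 with rfl | hq₀
  · simp [eisenstein_zero_right]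
  · obtain ⟨z, rfl⟩ := exists_nome_eq hq hq₀
    rw [← normalizedDeriv_eq_of_nome E_six_eq_eisenstein fun _ ↦ differentiableAt_eisenstein 3,
      E_six_ramanujan, E2_eq_eisenstein, E_four_eq_eisenstein, E_six_eq_eisenstein]

/-! ### The logarithmic derivative of the Euler product -/

lemma eta_eq_numerator (z : ℍ) :
    eta z = Function.Periodic.qParam 24 z * numerator 0 (nome z) := by
  rw [numerator, numeratorTerm_zero, ← tprod_one_sub_pow_eq_tsum (norm_nome_lt_one z), eta]
  simp [eta_q_eq_pow, nome]

/-- `V_2 = E_2`. -/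
lemma numerator_one {q : ℂ} (hq : ‖q‖ < 1) :
    numerator 1 q = eisenstein 1 q * numerator 0 q := by
  rw [numerator_succ 0 hq]
  rcases eq_or_ne q 0 with rfl | hq₀
  · simp [eisenstein_zero_right]
  obtain ⟨z, rfl⟩ := exists_nome_eq hq hq₀
  have hN : numerator 0 (nome z) ≠ 0 := by
    rw [numerator, numeratorTerm_zero]
    exact tsum_denominatorTerm_ne_zero hq
  have hd := (differentiableAt_numerator 0 hq).hasDerivAt.comp (z : ℂ) (hasDerivAt_nome z)
  have he : eta =ᶠ[𝓝 (z : ℂ)]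
      fun w ↦ Function.Periodic.qParam 24 w * (numerator 0 ∘ nome) w := by
    filter_upwards [isOpen_upperHalfPlaneSet.mem_nhds z.im_pos] with w hw
    exact eta_eq_numerator ⟨w, hw⟩
  -- The factor `qParam 24` contributes `2πi/24`, the source of the `1` in `1 + 24 θN_0/N_0 = E_2`.
  have h := logDeriv_eta_eq_E2 z
  rw [logDeriv_apply, he.deriv_eq, he.eq_of_nhds, ← logDeriv_apply,
    logDeriv_mul (z : ℂ) (Function.Periodic.qParam_ne_zero _) hN (by fun_prop) hd.differentiableAt, logDeriv_qParam, logDeriv_apply, hd.deriv, E2_eq_eisenstein,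
    Function.comp_apply] at h
  have : (Real.pi * Complex.I : ℂ) ≠ 0 := by simp [Real.pi_ne_zero]
  field_simp at h
  push_cast at h
  linear_combination h / 24

end RamanujanV

namespace RamanujanV

/-! ### The polynomials with coefficients `c_v` -/

lemma cv_of_neg {α β γ : ℤ} (h : α < 0 ∨ β < 0 ∨ γ < 0) : cv α β γ = 0 := by
  rw [cv, if_pos h]

lemma cv_of_mem_weightTriples_succ {t : ℕ} {p : ℕ × ℕ × ℕ} (hp : p ∈ weightTriples (t + 1)) :
    cv p.1 p.2.1 p.2.2 =
      (2 * p.1 + 8 * p.2.1 + 12 * p.2.2 - 1) * cv (p.1 - 1) p.2.1 p.2.2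
        - 2 * (p.1 + 1) * cv (p.1 + 1) (p.2.1 - 1) p.2.2
        - 8 * (p.2.1 + 1) * cv p.1 (p.2.1 + 1) (p.2.2 - 1)
        - 12 * (p.2.2 + 1) * cv p.1 (p.2.1 - 2) (p.2.2 + 1) := by
  obtain ⟨α, β, γ⟩ := p
  rw [mem_weightTriples] at hp
  dsimp only
  -- The weight `t + 1` is positive, which rules out the base case `(0, 0, 0)`.
  rw [cv, if_neg (by omega), if_neg (by omega)]

/-- The index shifts use truncated subtraction and are inverse to each other only off the boundary.
Requiring this only where the summands are nonzero suffices: boundary terms die by a zero factor or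
by `c_v` at a negative argument. -/
lemma sum_weightTriples_eq_sum_succ {t : ℕ} {f g : ℕ × ℕ × ℕ → ℂ} (i j : ℕ × ℕ × ℕ → ℕ × ℕ × ℕ)
    (hi : ∀ p ∈ weightTriples t, f p ≠ 0 →
      i p ∈ weightTriples (t + 1) ∧ j (i p) = p ∧ f p = g (i p))
    (hj : ∀ p ∈ weightTriples (t + 1), g p ≠ 0 →
      j p ∈ weightTriples t ∧ i (j p) = p ∧ f (j p) = g p) :
    ∑ p ∈ weightTriples t, f p = ∑ p ∈ weightTriples (t + 1), g p :=
  Finset.sum_bij_ne_zero (fun p _ _ ↦ i p) (fun p hp hf ↦ (hi p hp hf).1)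
    (fun p hp hf p' hp' hf' h ↦ by
      rw [← (hi p hp hf).2.1, ← (hi p' hp' hf').2.1, h])
    (fun p hp hg ↦ ⟨j p, (hj p hp hg).1, (hj p hp hg).2.2 ▸ hg, (hj p hp hg).2.1⟩)
    (fun p hp hf ↦ (hi p hp hf).2.2)

section Shift

variable (t : ℕ) (x y w : ℂ)

/-- Replacing `α` by `α - 1` changes the factor `1 + 2α` into `2α - 1`, as in the recursion. The
next three lemmas transpose `2y ∂/∂x`, `8w ∂/∂y` and `12y² ∂/∂w` in the same way. -/
lemma sum_shift_mul_left :
    ∑ p ∈ weightTriples t, (cv p.1 p.2.1 p.2.2 : ℂ) *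
        ((1 + 2 * p.1 + 8 * p.2.1 + 12 * p.2.2) * (x ^ (p.1 + 1) * y ^ p.2.1 * w ^ p.2.2)) =
      ∑ p ∈ weightTriples (t + 1), (2 * p.1 + 8 * p.2.1 + 12 * p.2.2 - 1) *
        (cv (p.1 - 1) p.2.1 p.2.2 : ℂ) * (x ^ p.1 * y ^ p.2.1 * w ^ p.2.2) := by
  refine sum_weightTriples_eq_sum_succ (fun p ↦ (p.1 + 1, p.2.1, p.2.2))
    (fun p ↦ (p.1 - 1, p.2.1, p.2.2)) ?_ ?_
  · rintro ⟨α, β, γ⟩ hp -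
    rw [mem_weightTriples] at hp ⊢
    refine ⟨by dsimp only; omega, by simp, ?_⟩
    push_cast
    rw [add_sub_cancel_right]
    ring
  · rintro ⟨_ | α, β, γ⟩ hp hg
    · exact absurd (by simp [cv_of_neg]) hg
    · rw [mem_weightTriples] at hp ⊢
      refine ⟨by dsimp only; omega, by simp, ?_⟩
      push_cast
      rw [add_sub_cancel_right]
      ring

lemma sum_shift_left :
    ∑ p ∈ weightTriples t, (cv p.1 p.2.1 p.2.2 : ℂ) *
        (2 * p.1 * (x ^ (p.1 - 1) * y ^ (p.2.1 + 1) * w ^ p.2.2)) =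
      ∑ p ∈ weightTriples (t + 1), 2 * (p.1 + 1) *
        (cv (p.1 + 1) (p.2.1 - 1) p.2.2 : ℂ) * (x ^ p.1 * y ^ p.2.1 * w ^ p.2.2) := by
  refine sum_weightTriples_eq_sum_succ (fun p ↦ (p.1 - 1, p.2.1 + 1, p.2.2))
    (fun p ↦ (p.1 + 1, p.2.1 - 1, p.2.2)) ?_ ?_
  · rintro ⟨_ | α, β, γ⟩ hp hf
    · exact absurd (by simp) hf
    · rw [mem_weightTriples] at hp ⊢
      refine ⟨by dsimp only; omega, by simp, ?_⟩
      simp only [Nat.add_sub_cancel]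
      push_cast
      rw [add_sub_cancel_right]
      ring
  · rintro ⟨α, _ | β, γ⟩ hp hg
    · exact absurd (by simp [cv_of_neg]) hg
    · rw [mem_weightTriples] at hp ⊢
      refine ⟨by dsimp only; omega, by simp, ?_⟩
      simp only [Nat.add_sub_cancel]
      push_cast
      rw [add_sub_cancel_right]
      ring

lemma sum_shift_middle :
    ∑ p ∈ weightTriples t, (cv p.1 p.2.1 p.2.2 : ℂ) *
        (8 * p.2.1 * (x ^ p.1 * y ^ (p.2.1 - 1) * w ^ (p.2.2 + 1))) =
      ∑ p ∈ weightTriples (t + 1), 8 * (p.2.1 + 1) *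
        (cv p.1 (p.2.1 + 1) (p.2.2 - 1) : ℂ) * (x ^ p.1 * y ^ p.2.1 * w ^ p.2.2) := by
  refine sum_weightTriples_eq_sum_succ (fun p ↦ (p.1, p.2.1 - 1, p.2.2 + 1))
    (fun p ↦ (p.1, p.2.1 + 1, p.2.2 - 1)) ?_ ?_
  · rintro ⟨α, _ | β, γ⟩ hp hf
    · exact absurd (by simp) hf
    · rw [mem_weightTriples] at hp ⊢
      refine ⟨by dsimp only; omega, by simp, ?_⟩
      simp only [Nat.add_sub_cancel]
      push_cast
      rw [add_sub_cancel_right]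
      ring
  · rintro ⟨α, β, _ | γ⟩ hp hg
    · exact absurd (by simp [cv_of_neg]) hg
    · rw [mem_weightTriples] at hp ⊢
      refine ⟨by dsimp only; omega, by simp, ?_⟩
      simp only [Nat.add_sub_cancel]
      push_cast
      rw [add_sub_cancel_right]
      ring

lemma sum_shift_right :
    ∑ p ∈ weightTriples t, (cv p.1 p.2.1 p.2.2 : ℂ) *
        (12 * p.2.2 * (x ^ p.1 * y ^ (p.2.1 + 2) * w ^ (p.2.2 - 1))) =
      ∑ p ∈ weightTriples (t + 1), 12 * (p.2.2 + 1) *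
        (cv p.1 (p.2.1 - 2) (p.2.2 + 1) : ℂ) * (x ^ p.1 * y ^ p.2.1 * w ^ p.2.2) := by
  refine sum_weightTriples_eq_sum_succ (fun p ↦ (p.1, p.2.1 + 2, p.2.2 - 1))
    (fun p ↦ (p.1, p.2.1 - 2, p.2.2 + 1)) ?_ ?_
  · rintro ⟨α, β, _ | γ⟩ hp hf
    · exact absurd (by simp) hf
    · rw [mem_weightTriples] at hp ⊢
      refine ⟨by dsimp only; omega, by simp, ?_⟩
      simp only [Nat.add_sub_cancel]
      push_cast
      rw [add_sub_cancel_right]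
      ring
  -- Both `β = 0` and `β = 1` make `β - 2` negative.
  · rintro ⟨α, _ | _ | β, γ⟩ hp hg
    · exact absurd (by simp [cv_of_neg]) hg
    · exact absurd (by simp [cv_of_neg]) hg
    · rw [mem_weightTriples] at hp ⊢
      refine ⟨by dsimp only; omega, by simp, ?_⟩
      have h : ((β + 1 + 1 : ℕ) : ℤ) - 2 = β := by push_cast; ring
      simp only [h, Nat.add_sub_cancel, Nat.reduceSubDiff]
      push_cast
      ring

/-- The recursion for the `c_v`, expressed through the polynomials with these coefficients. -/
lemma sum_cv_succ :
    ∑ p ∈ weightTriples (t + 1), (cv p.1 p.2.1 p.2.2 : ℂ) * x ^ p.1 * y ^ p.2.1 * w ^ p.2.2 =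
      ∑ p ∈ weightTriples t, (cv p.1 p.2.1 p.2.2 : ℂ) *
        ((1 + 2 * p.1 + 8 * p.2.1 + 12 * p.2.2) * (x ^ (p.1 + 1) * y ^ p.2.1 * w ^ p.2.2)
          - 2 * p.1 * (x ^ (p.1 - 1) * y ^ (p.2.1 + 1) * w ^ p.2.2)
          - 8 * p.2.1 * (x ^ p.1 * y ^ (p.2.1 - 1) * w ^ (p.2.2 + 1))
          - 12 * p.2.2 * (x ^ p.1 * y ^ (p.2.1 + 2) * w ^ (p.2.2 - 1))) := by
  simp only [mul_sub, Finset.sum_sub_distrib]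
  rw [sum_shift_mul_left, sum_shift_left, sum_shift_middle, sum_shift_right,
    ← Finset.sum_sub_distrib, ← Finset.sum_sub_distrib, ← Finset.sum_sub_distrib]
  refine Finset.sum_congr rfl fun p hp ↦ ?_
  rw [cv_of_mem_weightTriples_succ hp]
  push_cast
  ring

end Shift

/-- The right-hand side of the formula for `V_{2t}`. -/
noncomputable def eisensteinPolynomial (t : ℕ) (q : ℂ) : ℂ :=
  ∑ p ∈ weightTriples t, (cv p.1 p.2.1 p.2.2 : ℂ) *
    eisenstein 1 q ^ p.1 * eisenstein 2 q ^ p.2.1 * eisenstein 3 q ^ p.2.2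

lemma hasDerivAt_eisensteinPolynomial (t : ℕ) {q : ℂ} (hq : ‖q‖ < 1) :
    HasDerivAt (eisensteinPolynomial t)
      (∑ p ∈ weightTriples t,
        (((cv p.1 p.2.1 p.2.2 : ℂ) * (p.1 * eisenstein 1 q ^ (p.1 - 1) * deriv (eisenstein 1) q) *
          eisenstein 2 q ^ p.2.1 + (cv p.1 p.2.1 p.2.2 : ℂ) * eisenstein 1 q ^ p.1 *
          (p.2.1 * eisenstein 2 q ^ (p.2.1 - 1) * deriv (eisenstein 2) q)) *
          eisenstein 3 q ^ p.2.2 +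
        (cv p.1 p.2.1 p.2.2 : ℂ) * eisenstein 1 q ^ p.1 * eisenstein 2 q ^ p.2.1 *
          (p.2.2 * eisenstein 3 q ^ (p.2.2 - 1) * deriv (eisenstein 3) q))) q := by
  have h (k : ℕ) := (differentiableAt_eisenstein k hq).hasDerivAt
  exact HasDerivAt.fun_sum fun p _ ↦
    ((((h 1).fun_pow p.1).const_mul _).fun_mul ((h 2).fun_pow p.2.1)).fun_mul ((h 3).fun_pow p.2.2)

/-- By Ramanujan's equations `24θ` acts as `2(x²-y)∂/∂x + 8(xy-w)∂/∂y + 12(xw-y²)∂/∂w`; its diagonal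
part multiplies a monomial by `(2α+8β+12γ)x`. -/
lemma eisensteinPolynomial_succ (t : ℕ) {q : ℂ} (hq : ‖q‖ < 1) :
    eisensteinPolynomial (t + 1) q = eisenstein 1 q * eisensteinPolynomial t q +
      24 * (q * deriv (eisensteinPolynomial t) q) := by
  have h1 := mul_deriv_eisenstein_one hq
  have h2 := mul_deriv_eisenstein_two hq
  have h3 := mul_deriv_eisenstein_three hq
  rw [(hasDerivAt_eisensteinPolynomial t hq).deriv, eisensteinPolynomial, sum_cv_succ,
    eisensteinPolynomial, Finset.mul_sum, Finset.mul_sum, Finset.mul_sum,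
    ← Finset.sum_add_distrib]
  refine Finset.sum_congr rfl fun ⟨α, β, γ⟩ _ ↦ ?_
  -- The factor `a` keeps this true at `a = 0` despite the truncated exponent. With it, all powers
  -- can become independent atoms.
  have hpow (a : ℕ) (x : ℂ) : (a : ℂ) * x ^ a = a * x ^ (a - 1) * x := by
    rcases a with _ | a
    · simp
    · rw [Nat.add_sub_cancel, pow_succ, mul_assoc]
  have hα := hpow α (eisenstein 1 q)
  have hβ := hpow β (eisenstein 2 q)
  have hγ := hpow γ (eisenstein 3 q)
  dsimp only
  generalize eisenstein 1 q ^ (α - 1) = X at *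
  generalize eisenstein 2 q ^ (β - 1) = Y at *
  generalize eisenstein 3 q ^ (γ - 1) = W at *
  generalize deriv (eisenstein 1) q = d1 at *
  generalize deriv (eisenstein 2) q = d2 at *
  generalize deriv (eisenstein 3) q = d3 at *
  simp only [pow_succ (eisenstein 1 q) α, pow_succ _ β, pow_succ _ γ, pow_add _ β 2]
  generalize eisenstein 1 q ^ α = A at *
  generalize eisenstein 2 q ^ β = B at *
  generalize eisenstein 3 q ^ γ = G at *
  generalize (cv α β γ : ℂ) = c
  generalize eisenstein 1 q = x at *
  generalize eisenstein 2 q = y at *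
  generalize eisenstein 3 q = w at *
  linear_combination (-24 * c * α * X * B * G) * h1 + (-24 * c * A * β * Y * G) * h2 +
    (-24 * c * A * B * γ * W) * h3 + 2 * c * B * G * x * hα + 8 * c * A * G * x * hβ +
    12 * c * A * B * x * hγ

/-- The numerators are the polynomials `eisensteinPolynomial` times the Euler product. -/
lemma numerator_eq (t : ℕ) : ∀ q : ℂ, ‖q‖ < 1 →
    numerator t q = eisensteinPolynomial t q * numerator 0 q := by
  induction t with
  | zero =>
    intro q _
    have h : weightTriples 0 = {(0, 0, 0)} := by decide
    simp [eisensteinPolynomial, h, show cv 0 0 0 = 1 by rw [cv]; simp]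
  | succ t ih =>
    intro q hq
    -- Differentiating the induction hypothesis needs it near `q`, hence the induction over all `q`
    -- in the disc at once.
    have he : numerator t =ᶠ[nhds q] fun q ↦ eisensteinPolynomial t q * numerator 0 q := by
      filter_upwards [Metric.isOpen_ball.mem_nhds (show q ∈ Metric.ball (0 : ℂ) 1 by simpa)]
        with w hw
      exact ih w (by simpa using hw)
    have hd := (hasDerivAt_eisensteinPolynomial t hq).differentiableAt
    have h1 := numerator_one hq
    rw [numerator_succ 0 hq] at h1
    rw [numerator_succ t hq, he.deriv_eq, he.eq_of_nhds,
      deriv_fun_mul hd (differentiableAt_numerator 0 hq), eisensteinPolynomial_succ t hq]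
    linear_combination eisensteinPolynomial t q * h1

end RamanujanV

theorem theorem1p2 (t : ℕ) (q : ℂ) (hq : ‖q‖ < 1) :
    Summable (RamanujanV.numeratorTerm t q) ∧
    Summable (RamanujanV.denominatorTerm q) ∧
    (∑' n : ℤ, RamanujanV.denominatorTerm q n) ≠ 0 ∧
    (∀ k : ℕ, 1 ≤ k → Summable (RamanujanV.eisensteinTerm k q)) ∧
    RamanujanV.V t q =
      ∑ p ∈ RamanujanV.weightTriples t,
        (RamanujanV.cv p.1 p.2.1 p.2.2 : ℂ) *
          RamanujanV.eisenstein 1 q ^ p.1 *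
          RamanujanV.eisenstein 2 q ^ p.2.1 *
          RamanujanV.eisenstein 3 q ^ p.2.2 := by
  have hne := RamanujanV.tsum_denominatorTerm_ne_zero hq
  refine ⟨RamanujanV.summable_numeratorTerm t hq, RamanujanV.summable_denominatorTerm hq, hne,
    fun k _ ↦ RamanujanV.summable_eisensteinTerm k hq, ?_⟩
  rw [RamanujanV.V, div_eq_iff hne, ← RamanujanV.numeratorTerm_zero]
  exact RamanujanV.numerator_eq t q hq
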